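/- Let $X$ be a finite nonempty set. An association scheme on $X$ is a partition $S$ of $X\times X$ such that $1_X=\{(x,x)\mid x\in X\}\in S$; $s^*=\{(y,x)\mid (x,y)\in s\}\in S$ for every $s\in S$; and for all $s,t,u\in S$ the number $a_{stu}=|\{z\in X\mid (x,z)\in s,\ (z,y)\in t\}|$ does not depend on the choice of $(x,y)\in u$. The valency of $s$ is $n_s=a_{ss^*1_X}$, and the order of $U\subseteq S$ is $n_U=\sum_{u\in U}n_u$. The scheme is commutative if $a_{stu}=a_{tsu}$ for all $s,t,u\in S$, and it is a $p$-scheme if all valencies and $|X|$ are powers of the prime $p$. For $P,Q\subseteq S$ let $PQ=\{s\in S\mid a_{pqs}\neq 0\text{ for some }p\in P,\ q\in Q\}$. A nonempty $T\subseteq S$ is closed if $TT\subseteq T$, and a closed $T$ is strongly normal if $s^*Ts\subseteq T$ for all $s\in S$. The thin radical is $O_\theta(S)=\{s\in S\mid n_s=1\}$, and the thin residue $O^\theta(S)$ is the intersection of all strongly normal closed subsets of $S$. For closed $T$ put $xT=\{y\in X\mid (x,y)\in t\text{ for some }t\in T\}$ (and likewise $xU$ for any $U\subseteq S$); the quotient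 scheme $S/\!/T$ on $X/T=\{xT\mid x\in X\}$ consists of the relations $s^T=\{(xT,yT)\mid y\in xTsT\}$, $s\in S$. Write $C_n$ for the scheme on $\mathbb Z/n\mathbb Z$ with relations $\{(a,b)\mid b-a=g\}$, $g\in\mathbb Z/n\mathbb Z$. Two schemes are isomorphic if there are a bijection $\varphi$ between their point sets and a bijection $\psi$ between their sets of relations such that $(x,y)\in s$ implies $(\varphi(x),\varphi(y))\in\psi(s)$. The scheme $S$ is schurian if it is the set of orbits on $X\times X$, under the componentwise action, of a transitive permutation group on $X$. **Theorem.** Let $p$ be an odd prime and let $S$ be a commutative $p$-scheme of order $n_S=p^4$. Assume that one of the following conditions holds. 1. $O^\theta(S)=O_\theta(S)$, $n_{O_\theta(S)}=p^2$ and $S/\!/O^\theta(S)\cong C_{p^2}$. 2. $n_{O_\theta(S)}=n_{O^\theta(S)}=p^2$, $O^\theta(S)\neq O_\theta(S)$, and $n_s=p^2$ for each $s\in S\setminus O_\theta(S)O^\theta(S)$. 3. $n_{O_\theta(S)}=p^3$. Then $S$ is schurian. -/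

import Mathlib

/-- An association scheme on a finite set `X`: a partition of `X × X` containing the diagonal,
closed under transposition, and with constant intersection numbers.
Since the diagonal is a block of a partition, `X` is automatically nonempty. -/
structure AssocScheme (X : Type*) [Finite X] where
  /-- the set of relations of the scheme -/
  rels : Set (Set (X × X))
  isPartition : Setoid.IsPartition rels
  diag_mem : Set.diagonal X ∈ rels
  transpose_mem : ∀ s ∈ rels, Prod.swap ⁻¹' s ∈ rels
  regular : ∀ s ∈ rels, ∀ t ∈ rels, ∀ u ∈ rels, ∀ x y x' y' : X, (x, y) ∈ u → (x', y') ∈ u →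
    Set.ncard {z : X | (x, z) ∈ s ∧ (z, y) ∈ t} = Set.ncard {z : X | (x', z) ∈ s ∧ (z, y') ∈ t}

namespace AssocScheme

section Basic

variable {X : Type*} [Finite X] (S : AssocScheme X)

/-- The elements of the scheme, as a type. -/
abbrev Rel : Type _ := {s : Set (X × X) // s ∈ S.rels}

/-- The diagonal relation `1_X`. -/
def one : S.Rel := ⟨Set.diagonal X, S.diag_mem⟩

/-- The transposed relation `s^*`. -/
def star (s : S.Rel) : S.Rel := ⟨Prod.swap ⁻¹' s.1, S.transpose_mem s.1 s.2⟩

theorem rel_nonempty (u : S.Rel) : u.1.Nonempty :=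
  Setoid.nonempty_of_mem_partition S.isPartition u.2

/-- The intersection number `a_{stu} = |xs ∩ yt^*|`, computed at some pair `(x, y) ∈ u`. -/
noncomputable def inter (s t u : S.Rel) : ℕ :=
  Set.ncard {z : X | ((S.rel_nonempty u).some.1, z) ∈ s.1 ∧ (z, (S.rel_nonempty u).some.2) ∈ t.1}

/-- `a_{stu}` may be computed at every pair `(x, y) ∈ u`. -/
theorem inter_eq (s t u : S.Rel) {x y : X} (h : (x, y) ∈ u.1) :
    S.inter s t u = Set.ncard {z : X | (x, z) ∈ s.1 ∧ (z, y) ∈ t.1} :=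
  S.regular _ s.2 _ t.2 _ u.2 _ _ _ _ (S.rel_nonempty u).some_mem h

/-- The valency `n_s = a_{s s^* 1_X}`. -/
noncomputable def valency (s : S.Rel) : ℕ := S.inter s (S.star s) S.one

/-- The order `n_U`, the sum of the valencies of the elements of `U`. -/
noncomputable def order (U : Set S.Rel) : ℕ := ∑ᶠ u ∈ U, S.valency u

/-- The complex product `PQ`. -/
def complexMul (P Q : Set S.Rel) : Set S.Rel :=
  {s | ∃ p ∈ P, ∃ q ∈ Q, S.inter p q s ≠ 0}

/-- Closed subsets of `S`. -/
def IsClosedSubset (T : Set S.Rel) : Prop :=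
  T.Nonempty ∧ S.complexMul T T ⊆ T

/-- Strongly normal closed subsets: `s^* T s ⊆ T` for every `s`. -/
def IsStronglyNormal (T : Set S.Rel) : Prop :=
  S.IsClosedSubset T ∧ ∀ s : S.Rel, S.complexMul (S.complexMul {S.star s} T) {s} ⊆ T

/-- The thin radical `O_θ(S)`. -/
def thinRadical : Set S.Rel := {s | S.valency s = 1}

/-- The thin residue `O^θ(S)`, the intersection of all strongly normal closed subsets. -/
def thinResidue : Set S.Rel := ⋂₀ {T | S.IsStronglyNormal T}

/-- `xU`, the union of the sets `xu` with `u ∈ U`. -/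
def nbhd (x : X) (U : Set S.Rel) : Set X := {y | ∃ u ∈ U, (x, y) ∈ u.1}

/-- `X / T`, the set of all `xT` with `x ∈ X`. -/
abbrev PointQuotient (T : Set S.Rel) : Type _ :=
  {A : Set X // A ∈ Set.range fun x => S.nbhd x T}

/-- The class `xT` as an element of `X / T`. -/
def toPointQuotient (T : Set S.Rel) (x : X) : S.PointQuotient T := ⟨S.nbhd x T, x, rfl⟩

/-- `s^T`, the set of all `(xT, yT)` with `y ∈ xTsT`. -/
def quotientRel (T : Set S.Rel) (s : S.Rel) : Set (S.PointQuotient T × S.PointQuotient T) :=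
  {q | ∃ x y : X, y ∈ S.nbhd x (S.complexMul (S.complexMul T {s}) T) ∧
    q = (S.toPointQuotient T x, S.toPointQuotient T y)}

/-- The set of relations `S // T` of the quotient scheme on `X / T`. -/
def quotientRels (T : Set S.Rel) : Set (Set (S.PointQuotient T × S.PointQuotient T)) :=
  Set.range (S.quotientRel T)

/-- The scheme is commutative. -/
def IsCommutative : Prop := ∀ s t u : S.Rel, S.inter s t u = S.inter t s u

/-- `S` is a `p`-scheme: all valencies and `|X|` are powers of `p`. -/
def IsPScheme (p : ℕ) : Prop :=
  (∀ s : S.Rel, ∃ k : ℕ, S.valency s = p ^ k) ∧ ∃ k : ℕ, Nat.card X = p ^ k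

/-- `S` is schurian: it is the set of orbits on `X × X`, under the componentwise action, of a
transitive permutation group on `X`. -/
def IsSchurian : Prop :=
  ∃ G : Subgroup (Equiv.Perm X), MulAction.IsPretransitive G X ∧
    S.rels = Set.range fun q : X × X => MulAction.orbit G q

end Basic

/-- Isomorphism of schemes, given by their sets of relations: a bijection between the points and
a bijection between the relations that are compatible. -/
def Isomorphic {X Y : Type*} (R : Set (Set (X × X))) (R' : Set (Set (Y × Y))) : Prop :=
  ∃ (φ : X ≃ Y) (ψ : R ≃ R'), ∀ (s : R) (x y : X), (x, y) ∈ s.1 → (φ x, φ y) ∈ (ψ s).1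

/-- The relations of the thin scheme of the cyclic group `C_n`, which are the sets
`{(a, b) | a + g = b}` for `g ∈ C_n`. -/
def cyclicRels (n : ℕ) : Set (Set (ZMod n × ZMod n)) :=
  Set.range fun g : ZMod n => {q : ZMod n × ZMod n | q.1 + g = q.2}

end AssocScheme

/-!
Write `r(x, y)` for the relation containing `(x, y)`. If every partial isomorphism of `S` extends by
any one further point, then the orbitals of the automorphism group are the relations of `S`, and `S`
is schurian. To extend a partial isomorphism `g` to `y`, choose a base point `a` of its domain and a
point `y'` with `r(g a, y') = r(a, y)`. For another point `d` of the domain, `r(g d, y') = r(d, y)`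
follows when `r(a, y)` is thin, or when `v = r(d, y)` absorbs `s = r(a, d)`, meaning `s* s v = {v}`.
So it suffices to find a closed set `U` such that relations outside `U` absorb everything and the
nonthin ones in `U` absorb all of `U`; then the base point is chosen with `r(a, y)` thin, or else
in `U`, if possible.

Let `S` be commutative, and let `v* v` consist of thin relations. Then `v` absorbs `s` as soon as
`s* s ⊆ v* v`, and `{u | u* u ⊆ v* v}` is a closed set containing `O_θ(S)`.

* Condition 1. Hence `s* s ⊆ v* v` whenever the image of `s` in `C_{p²}` is a multiple of that of
  `v`. The subgroups of `C_{p²}` form a chain, and `U` is the preimage of the one of order `p`.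
* Condition 2. Put `R = O^θ(S)` and `U = O_θ(S) R`. Every nonthin `v` in `U` has
  `v* v = O_θ(S) ∩ R`, while a relation `v` outside `U` satisfies `v R = {v}` because `n_v = n_R`,
  and `R` contains every `s* s`.
* Condition 3. Take `U = S`. For nonthin `v` the set `{u | u* u ⊆ v* v}` properly contains `O_θ(S)`,
  which has prime index, so it is all of `S`.
-/

theorem ncard_eq_ncard_image_mul {X Y : Type*} [Finite X] (f : X → Y) {A : Set X} {k : ℕ}
    (h : ∀ y ∈ A, Set.ncard {z ∈ A | f z = f y} = k) : A.ncard = (f '' A).ncard * k := by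
  classical
  have := Fintype.ofFinite X
  rw [Set.ncard_eq_toFinset_card', Set.ncard_eq_toFinset_card', Set.toFinset_image,
    Finset.card_eq_sum_card_image f, Finset.sum_const_nat]
  intro c hc
  obtain ⟨y, hy, rfl⟩ := Finset.mem_image.1 hc
  rw [← h y (by simpa using hy), Set.ncard_eq_toFinset_card']
  congr 1
  ext z
  simp

theorem zmod_prime_pow_isUnit_of_not_dvd {p k : ℕ} (hp : p.Prime) (hk : k ≠ 0) {a : ZMod (p ^ k)}
    (ha : ¬ (p : ZMod (p ^ k)) ∣ a) : IsUnit a := by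
  have : NeZero (p ^ k) := ⟨pow_ne_zero k hp.ne_zero⟩
  obtain ⟨m, rfl⟩ := ZMod.natCast_zmod_surjective a
  rw [ZMod.isUnit_natCast_iff_not_dvd_pow hp (Nat.pos_of_ne_zero hk)]
  exact fun h => ha (Nat.cast_dvd_cast h)

theorem zmod_prime_sq_dvd_of_dvd_of_ne_zero {p : ℕ} (hp : p.Prime) {d e : ZMod (p ^ 2)}
    (hd : (p : ZMod (p ^ 2)) ∣ d) (he : (p : ZMod (p ^ 2)) ∣ e) (hne : e ≠ 0) : e ∣ d := by
  obtain ⟨c, rfl⟩ := he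
  have hc : IsUnit c := zmod_prime_pow_isUnit_of_not_dvd hp two_ne_zero fun ⟨b, hb⟩ => hne <| by
    rw [hb, ← mul_assoc, ← sq, ← Nat.cast_pow, ZMod.natCast_self, zero_mul]
  exact hc.mul_right_dvd.2 hd

namespace AssocScheme

section Points

variable {X : Type*} [Finite X] (S : AssocScheme X)

theorem exists_mem_rel (x y : X) : ∃ s : S.Rel, (x, y) ∈ s.1 := by
  obtain ⟨s, ⟨hs, hxy⟩, -⟩ := S.isPartition.2 (x, y)
  exact ⟨⟨s, hs⟩, hxy⟩

/-- The relation `r(x, y)` of `S` containing the pair `(x, y)`; thus `(x, y) ∈ s` becomes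
`S.rel x y = s`. -/
noncomputable def rel (x y : X) : S.Rel := (S.exists_mem_rel x y).choose

variable {S}

theorem mem_iff_rel_eq {s : S.Rel} {x y : X} : (x, y) ∈ s.1 ↔ S.rel x y = s := by
  have hmem : (x, y) ∈ (S.rel x y).1 := (S.exists_mem_rel x y).choose_spec
  refine ⟨fun h => ?_, fun h => h ▸ hmem⟩
  obtain ⟨t, -, ht⟩ := S.isPartition.2 (x, y)
  exact Subtype.ext ((ht _ ⟨(S.rel x y).2, hmem⟩).trans (ht _ ⟨s.2, h⟩).symm)

theorem exists_rel_eq (s : S.Rel) : ∃ x y, S.rel x y = s := by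
  obtain ⟨⟨x, y⟩, h⟩ := S.rel_nonempty s
  exact ⟨x, y, mem_iff_rel_eq.1 h⟩

theorem subset_iff_rel {P Q : Set S.Rel} :
    P ⊆ Q ↔ ∀ x y, S.rel x y ∈ P → S.rel x y ∈ Q := by
  refine ⟨fun h x y hxy => h hxy, fun h s hs => ?_⟩
  obtain ⟨x, y, rfl⟩ := exists_rel_eq s
  exact h x y hs

theorem inter_rel (s t : S.Rel) (x y : X) :
    S.inter s t (S.rel x y) = Set.ncard {z : X | S.rel x z = s ∧ S.rel z y = t} := by
  rw [S.inter_eq s t _ (mem_iff_rel_eq.2 rfl)]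
  simp only [mem_iff_rel_eq]

theorem inter_rel_ne_zero {s t : S.Rel} {x y : X} :
    S.inter s t (S.rel x y) ≠ 0 ↔ ∃ z, S.rel x z = s ∧ S.rel z y = t := by
  rw [inter_rel, ← Nat.pos_iff_ne_zero, Set.ncard_pos]
  rfl

theorem exists_triangle {x y x' y' : X} (h : S.rel x y = S.rel x' y') (z : X) :
    ∃ z', S.rel x' z' = S.rel x z ∧ S.rel z' y' = S.rel z y := by
  rw [← inter_rel_ne_zero, ← h, inter_rel_ne_zero]
  exact ⟨z, rfl, rfl⟩

theorem IsCommutative.exists_parallelogram (hc : S.IsCommutative) (x z y : X) :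
    ∃ z', S.rel x z' = S.rel z y ∧ S.rel z' y = S.rel x z := by
  rw [← inter_rel_ne_zero, hc, inter_rel_ne_zero]
  exact ⟨z, rfl, rfl⟩

theorem star_rel (x y : X) : S.star (S.rel x y) = S.rel y x :=
  have h : (y, x) ∈ (S.star (S.rel x y)).1 := mem_iff_rel_eq (s := S.rel x y).2 rfl
  (mem_iff_rel_eq.1 h).symm

theorem rel_swap_eq {x y x' y' : X} (h : S.rel x y = S.rel x' y') : S.rel y x = S.rel y' x' := by
  rw [← star_rel, h, star_rel]

theorem rel_eq_star {s : S.Rel} {x y : X} : S.rel x y = S.star s ↔ S.rel y x = s := by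
  obtain ⟨a, b, rfl⟩ := exists_rel_eq s
  rw [star_rel]
  exact ⟨rel_swap_eq, rel_swap_eq⟩

theorem rel_eq_one {x y : X} : S.rel x y = S.one ↔ x = y := by
  rw [← mem_iff_rel_eq]
  exact Set.mem_diagonal_iff

theorem rel_self (x : X) : S.rel x x = S.one := rel_eq_one.2 rfl

theorem exists_rel_right_eq (s : S.Rel) (x : X) : ∃ y, S.rel x y = s := by
  obtain ⟨a, b, rfl⟩ := exists_rel_eq s
  obtain ⟨y, hy, -⟩ := exists_triangle ((rel_self a).trans (rel_self x).symm) b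
  exact ⟨y, hy⟩

theorem exists_rel_left_eq (s : S.Rel) (y : X) : ∃ x, S.rel x y = s := by
  obtain ⟨x, hx⟩ := exists_rel_right_eq (S.star s) y
  exact ⟨x, rel_eq_star.1 hx⟩

theorem mem_nbhd {U : Set S.Rel} {x y : X} : y ∈ S.nbhd x U ↔ S.rel x y ∈ U := by
  constructor
  · rintro ⟨u, hu, hxy⟩
    rwa [mem_iff_rel_eq.1 hxy]
  · exact fun h => ⟨_, h, mem_iff_rel_eq.2 rfl⟩

theorem mem_nbhd_singleton {s : S.Rel} {x y : X} : y ∈ S.nbhd x {s} ↔ S.rel x y = s := mem_nbhd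

theorem rel_mem_complexMul {P Q : Set S.Rel} {x y : X} :
    S.rel x y ∈ S.complexMul P Q ↔ ∃ z, S.rel x z ∈ P ∧ S.rel z y ∈ Q := by
  constructor
  · rintro ⟨p, hp, q, hq, h⟩
    obtain ⟨z, rfl, rfl⟩ := inter_rel_ne_zero.1 h
    exact ⟨z, hp, hq⟩
  · rintro ⟨z, hp, hq⟩
    exact ⟨_, hp, _, hq, inter_rel_ne_zero.2 ⟨z, rfl, rfl⟩⟩

theorem complexMul_mono {P P' Q Q' : Set S.Rel} (hP : P ⊆ P') (hQ : Q ⊆ Q') :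
    S.complexMul P Q ⊆ S.complexMul P' Q' :=
  fun _ ⟨p, hp, q, hq, h⟩ => ⟨p, hP hp, q, hQ hq, h⟩

theorem IsCommutative.complexMul_subset_comm (hc : S.IsCommutative) (P Q : Set S.Rel) :
    S.complexMul P Q ⊆ S.complexMul Q P :=
  fun _ ⟨p, hp, q, hq, h⟩ => ⟨q, hq, p, hp, by rwa [hc]⟩

end Points

section Order

variable {X : Type*} [Finite X] {S : AssocScheme X}

theorem ncard_nbhd_singleton (x : X) (s : S.Rel) : (S.nbhd x {s}).ncard = S.valency s := by
  rw [valency, ← rel_self x, inter_rel]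
  simp only [rel_eq_star, and_self]
  congr 1
  ext y
  exact mem_nbhd_singleton

theorem ncard_nbhd (x : X) (U : Set S.Rel) : (S.nbhd x U).ncard = S.order U := by
  have hunion : S.nbhd x U = ⋃ s ∈ U, S.nbhd x {s} := by
    ext y
    simp only [Set.mem_iUnion₂, mem_nbhd, Set.mem_singleton_iff, exists_prop, exists_eq_right']
  rw [hunion, (Set.toFinite U).ncard_biUnion fun _ _ => Set.toFinite _]
  · exact finsum_mem_congr rfl fun s _ => ncard_nbhd_singleton x s
  · intro s _ t _ hst
    refine Set.disjoint_left.2 fun y hs ht => hst ?_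
    exact (mem_nbhd_singleton.1 hs).symm.trans (mem_nbhd_singleton.1 ht)

theorem ncard_inter_eq_finsum (s : S.Rel) (T : Set S.Rel) (x y : X) :
    Set.ncard {z | S.rel x z = s ∧ S.rel z y ∈ T} = ∑ᶠ t ∈ T, S.inter s t (S.rel x y) := by
  have hunion : {z | S.rel x z = s ∧ S.rel z y ∈ T} =
      ⋃ t ∈ T, {z | S.rel x z = s ∧ S.rel z y = t} := by
    ext z
    simp only [Set.mem_iUnion₂, Set.mem_ofPred_eq, exists_prop]
    exact ⟨fun h => ⟨_, h.2, h.1, rfl⟩, fun ⟨_, ht, hs, h⟩ => ⟨hs, h ▸ ht⟩⟩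
  rw [hunion, (Set.toFinite T).ncard_biUnion fun _ _ => Set.toFinite _]
  · exact finsum_mem_congr rfl fun t _ => (inter_rel s t x y).symm
  · intro t _ t' _ htt'
    exact Set.disjoint_left.2 fun z hz hz' => htt' (hz.2.symm.trans hz'.2)

theorem valency_pos (s : S.Rel) : 0 < S.valency s := by
  obtain ⟨x, y, h⟩ := exists_rel_eq s
  rw [← ncard_nbhd_singleton x, Set.ncard_pos]
  exact ⟨y, mem_nbhd_singleton.2 h⟩

theorem nbhd_subset_nbhd {U V : Set S.Rel} (hUV : U ⊆ V) (x : X) : S.nbhd x U ⊆ S.nbhd x V :=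
  fun _ hy => mem_nbhd.2 (hUV (mem_nbhd.1 hy))

theorem eq_of_subset_of_order_le {U V : Set S.Rel} (hUV : U ⊆ V) (h : S.order V ≤ S.order U) :
    U = V := by
  refine hUV.antisymm (subset_iff_rel.2 fun x y hy => ?_)
  rw [← ncard_nbhd x, ← ncard_nbhd x] at h
  rw [← mem_nbhd, Set.eq_of_subset_of_ncard_le (nbhd_subset_nbhd hUV x) h]
  exact mem_nbhd.2 hy

theorem order_add_order_le {U V W : Set S.Rel} (hUV : Disjoint U V) (hU : U ⊆ W) (hV : V ⊆ W) :
    S.order U + S.order V ≤ S.order W := by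
  obtain ⟨x, -⟩ := exists_rel_eq S.one
  rw [order, order, ← finsum_mem_union hUV (Set.toFinite U) (Set.toFinite V)]
  change S.order (U ∪ V) ≤ _
  rw [← ncard_nbhd x, ← ncard_nbhd x]
  exact Set.ncard_le_ncard (nbhd_subset_nbhd (Set.union_subset hU hV) x)

end Order

section Closed

variable {X : Type*} [Finite X] {S : AssocScheme X} {T R : Set S.Rel}

theorem isClosedSubset_of_rel_trans (hone : S.one ∈ T)
    (htrans : ∀ x y z, S.rel x y ∈ T → S.rel y z ∈ T → S.rel x z ∈ T) : S.IsClosedSubset T := by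
  refine ⟨⟨S.one, hone⟩, subset_iff_rel.2 fun x y hxy => ?_⟩
  obtain ⟨z, hxz, hzy⟩ := rel_mem_complexMul.1 hxy
  exact htrans x z y hxz hzy

theorem isClosedSubset_univ : S.IsClosedSubset Set.univ :=
  isClosedSubset_of_rel_trans trivial fun _ _ _ _ _ => trivial

namespace IsClosedSubset

theorem rel_trans (hT : S.IsClosedSubset T) {x y z : X} (hxy : S.rel x y ∈ T)
    (hyz : S.rel y z ∈ T) : S.rel x z ∈ T :=
  hT.2 (rel_mem_complexMul.2 ⟨y, hxy, hyz⟩)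

theorem nbhd_eq_nbhd (hT : S.IsClosedSubset T) {x y : X} (hxy : S.rel x y ∈ T) :
    S.nbhd x T = S.nbhd y T := by
  refine (Set.eq_of_subset_of_ncard_le (fun z hz => ?_) ?_).symm
  · exact mem_nbhd.2 (hT.rel_trans hxy (mem_nbhd.1 hz))
  · rw [ncard_nbhd, ncard_nbhd]

theorem one_mem (hT : S.IsClosedSubset T) : S.one ∈ T := by
  obtain ⟨t, ht⟩ := hT.1
  obtain ⟨x, y, rfl⟩ := exists_rel_eq t
  rw [← rel_self y, ← mem_nbhd, ← hT.nbhd_eq_nbhd ht]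
  exact mem_nbhd.2 ht

theorem rel_self_mem (hT : S.IsClosedSubset T) (x : X) : S.rel x x ∈ T := by
  rw [rel_self]
  exact hT.one_mem

theorem rel_symm (hT : S.IsClosedSubset T) {x y : X} (hxy : S.rel x y ∈ T) : S.rel y x ∈ T := by
  rw [← mem_nbhd, ← hT.nbhd_eq_nbhd hxy]
  exact mem_nbhd.2 (hT.rel_self_mem x)

theorem sInter {𝒯 : Set (Set S.Rel)} (h : ∀ T ∈ 𝒯, S.IsClosedSubset T) :
    S.IsClosedSubset (⋂₀ 𝒯) :=
  ⟨⟨S.one, fun T hT => (h T hT).one_mem⟩, Set.subset_sInter fun T hT =>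
    (complexMul_mono (Set.sInter_subset_of_mem hT) (Set.sInter_subset_of_mem hT)).trans (h T hT).2⟩

theorem inter (hT : S.IsClosedSubset T) (hR : S.IsClosedSubset R) : S.IsClosedSubset (T ∩ R) := by
  rw [← Set.sInter_pair]
  exact sInter (by simp [hT, hR])

theorem complexMul (hc : S.IsCommutative) (hT : S.IsClosedSubset T) (hR : S.IsClosedSubset R) :
    S.IsClosedSubset (S.complexMul T R) := by
  refine isClosedSubset_of_rel_trans ?_ fun x y z hxy hyz => ?_
  · obtain ⟨x, -⟩ := exists_rel_eq S.one
    rw [← rel_self x, rel_mem_complexMul]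
    exact ⟨x, hT.rel_self_mem x, hR.rel_self_mem x⟩
  · obtain ⟨a, hxa, hay⟩ := rel_mem_complexMul.1 hxy
    obtain ⟨b, hyb, hbz⟩ := rel_mem_complexMul.1 hyz
    obtain ⟨c, hac, hcb⟩ := hc.exists_parallelogram a y b
    exact rel_mem_complexMul.2 ⟨c, hT.rel_trans hxa (hac ▸ hyb), hR.rel_trans (hcb ▸ hay) hbz⟩

theorem toPointQuotient_eq_iff (hT : S.IsClosedSubset T) {x y : X} :
    S.toPointQuotient T x = S.toPointQuotient T y ↔ S.rel x y ∈ T := by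
  refine Subtype.ext_iff.trans ⟨fun h : S.nbhd x T = S.nbhd y T => ?_, hT.nbhd_eq_nbhd⟩
  rw [← mem_nbhd, h]
  exact mem_nbhd.2 (hT.rel_self_mem y)

end IsClosedSubset

theorem isStronglyNormal_thinResidue : S.IsStronglyNormal S.thinResidue :=
  ⟨.sInter fun _ hT => hT.1, fun s => Set.subset_sInter fun _ hT =>
    (complexMul_mono (complexMul_mono subset_rfl (Set.sInter_subset_of_mem hT))
      subset_rfl).trans (hT.2 s)⟩

theorem mem_thinRadical_iff {s : S.Rel} (x : X) :
    s ∈ S.thinRadical ↔ ∃! y, S.rel x y = s := by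
  rw [thinRadical, Set.mem_ofPred_eq, ← ncard_nbhd_singleton x, Set.ncard_eq_one]
  simp only [Set.eq_singleton_iff_unique_mem, mem_nbhd_singleton]
  rfl

theorem eq_of_rel_eq_of_mem_thinRadical {x y z : X} (hxy : S.rel x y ∈ S.thinRadical)
    (hxz : S.rel x z = S.rel x y) : z = y :=
  ((mem_thinRadical_iff x).1 hxy).unique hxz rfl

theorem isClosedSubset_thinRadical : S.IsClosedSubset S.thinRadical := by
  refine isClosedSubset_of_rel_trans ?_ fun x y z hxy hyz => ?_
  · obtain ⟨x, -⟩ := exists_rel_eq S.one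
    exact (mem_thinRadical_iff x).2 ⟨x, rel_self x, fun y hy => (rel_eq_one.1 hy).symm⟩
  · refine (mem_thinRadical_iff x).2 ⟨z, rfl, fun w hw => ?_⟩
    obtain ⟨y', hxy', hy'w⟩ := exists_triangle hw.symm y
    obtain rfl := eq_of_rel_eq_of_mem_thinRadical hxy hxy'
    exact eq_of_rel_eq_of_mem_thinRadical hyz hy'w

end Closed

section Counting

variable {X : Type*} [Finite X] {S : AssocScheme X} {T R W : Set S.Rel}

namespace IsClosedSubset

theorem order_pos (hT : S.IsClosedSubset T) : 0 < S.order T := by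
  obtain ⟨x, -⟩ := exists_rel_eq S.one
  rw [← ncard_nbhd x, Set.ncard_pos]
  exact ⟨x, mem_nbhd.2 (hT.rel_self_mem x)⟩

theorem ncard_eq_ncard_image_mul_order (hT : S.IsClosedSubset T) {A : Set X}
    (hA : ∀ y ∈ A, S.nbhd y T ⊆ A) :
    A.ncard = (S.toPointQuotient T '' A).ncard * S.order T := by
  refine ncard_eq_ncard_image_mul _ fun y hy => ?_
  rw [← ncard_nbhd y T]
  congr 1
  ext z
  rw [Set.mem_ofPred_eq, hT.toPointQuotient_eq_iff, mem_nbhd]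
  exact ⟨fun h => hT.rel_symm h.2, fun h => ⟨hA y hy (mem_nbhd.2 h), hT.rel_symm h⟩⟩

theorem order_dvd_order (hT : S.IsClosedSubset T) (hR : S.IsClosedSubset R) (hTR : T ⊆ R) :
    S.order T ∣ S.order R := by
  obtain ⟨x, -⟩ := exists_rel_eq S.one
  rw [← ncard_nbhd x R, hT.ncard_eq_ncard_image_mul_order]
  · exact dvd_mul_left _ _
  · exact fun y hy z hz => mem_nbhd.2 (hR.rel_trans (mem_nbhd.1 hy) (hTR (mem_nbhd.1 hz)))

theorem eq_of_order_eq_prime_mul {p : ℕ} (hp : p.Prime) (hT : S.IsClosedSubset T)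
    (hW : S.IsClosedSubset W) (hR : S.IsClosedSubset R) (hTW : T ⊆ W) (hWR : W ⊆ R) (hne : T ≠ W)
    (hord : S.order R = p * S.order T) : W = R := by
  obtain ⟨m, hm⟩ := hT.order_dvd_order hW hTW
  have hmp : m ∣ p := by
    refine Nat.dvd_of_mul_dvd_mul_left hT.order_pos ?_
    rw [← hm, mul_comm, ← hord]
    exact hW.order_dvd_order hR hWR
  obtain rfl | rfl := (Nat.dvd_prime hp).1 hmp
  · exact absurd (eq_of_subset_of_order_le hTW (by rw [hm, mul_one])) hne
  · exact eq_of_subset_of_order_le hWR (by rw [hm, hord, mul_comm])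

/-- The quotient is the number of classes `yT` that meet `xs`: each contains `n_T` points of `xsT`,
and they all contain equally many points of `xs`. -/
theorem exists_order_complexMul_singleton (hT : S.IsClosedSubset T) (s : S.Rel) :
    ∃ m, m ∣ S.valency s ∧ S.order (S.complexMul {s} T) = m * S.order T := by
  obtain ⟨x, -⟩ := exists_rel_eq s
  refine ⟨(S.toPointQuotient T '' S.nbhd x {s}).ncard, ?_, ?_⟩
  · rw [← ncard_nbhd_singleton x, ncard_eq_ncard_image_mul (S.toPointQuotient T)
      (k := ∑ᶠ t ∈ T, S.inter s t s)]
    · exact dvd_mul_right _ _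
    · intro y hy
      simp only [mem_nbhd_singleton, hT.toPointQuotient_eq_iff]
      rw [ncard_inter_eq_finsum, mem_nbhd_singleton.1 hy]
  · have himage : S.toPointQuotient T '' S.nbhd x {s} =
        S.toPointQuotient T '' S.nbhd x (S.complexMul {s} T) := by
      refine Set.Subset.antisymm ?_ ?_
      · refine Set.image_mono fun y hy => mem_nbhd.2 (rel_mem_complexMul.2 ⟨y, ?_⟩)
        exact ⟨mem_nbhd.1 hy, hT.rel_self_mem y⟩
      · rintro _ ⟨z, hz, rfl⟩
        obtain ⟨y, hxy, hyz⟩ := rel_mem_complexMul.1 (mem_nbhd.1 hz)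
        exact ⟨y, mem_nbhd.2 hxy, hT.toPointQuotient_eq_iff.2 hyz⟩
    rw [himage, ← ncard_nbhd x, hT.ncard_eq_ncard_image_mul_order]
    intro y hy z hz
    obtain ⟨w, hxw, hwy⟩ := rel_mem_complexMul.1 (mem_nbhd.1 hy)
    exact mem_nbhd.2 (rel_mem_complexMul.2 ⟨w, hxw, hT.rel_trans hwy (mem_nbhd.1 hz)⟩)

end IsClosedSubset

end Counting

section StarMulSelf

variable {X : Type*} [Finite X] (S : AssocScheme X)

/-- The complex product `s^* s`: the relations between two points of a common set `xs`. It is the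
trivial `{1}` exactly when `s` is thin, and the thin residue is generated by these sets. -/
def starMulSelf (s : S.Rel) : Set S.Rel := S.complexMul {S.star s} {s}

variable {S} {T R H : Set S.Rel} {s v : S.Rel}

theorem rel_mem_starMulSelf {x y : X} :
    S.rel x y ∈ S.starMulSelf s ↔ ∃ a, S.rel a x = s ∧ S.rel a y = s := by
  simp only [starMulSelf, rel_mem_complexMul, Set.mem_singleton_iff, rel_eq_star]

theorem starMulSelf_subset_iff :
    S.starMulSelf s ⊆ H ↔ ∀ a x y, S.rel a x = s → S.rel a y = s → S.rel x y ∈ H := by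
  simp only [subset_iff_rel, rel_mem_starMulSelf]
  exact ⟨fun h a x y hx hy => h x y ⟨a, hx, hy⟩, fun h x y ⟨a, hx, hy⟩ => h a x y hx hy⟩

theorem IsStronglyNormal.starMulSelf_subset (hT : S.IsStronglyNormal T) (s : S.Rel) :
    S.starMulSelf s ⊆ T :=
  starMulSelf_subset_iff.2 fun a _ _ hx hy => hT.2 s <| rel_mem_complexMul.2
    ⟨a, rel_mem_complexMul.2 ⟨a, rel_eq_star.2 hx, hT.1.rel_self_mem a⟩, hy⟩

theorem starMulSelf_subset_singleton_one (hs : s ∈ S.thinRadical) : S.starMulSelf s ⊆ {S.one} :=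
  starMulSelf_subset_iff.2 fun a _ _ hx hy =>
    rel_eq_one.2 (((mem_thinRadical_iff a).1 hs).unique hx hy)

theorem starMulSelf_subset_of_mem_thinRadical (hs : s ∈ S.thinRadical) (hH : S.IsClosedSubset H) :
    S.starMulSelf s ⊆ H :=
  (starMulSelf_subset_singleton_one hs).trans (Set.singleton_subset_iff.2 hH.one_mem)

theorem starMulSelf_subset_of_order_complexMul_le (hT : S.IsClosedSubset T)
    (h : S.order (S.complexMul {s} T) ≤ S.order T) : S.starMulSelf s ⊆ T := by
  refine starMulSelf_subset_iff.2 fun a x y hx hy => ?_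
  have hsub : S.nbhd x T ⊆ S.nbhd a (S.complexMul {s} T) := fun z hz =>
    mem_nbhd.2 (rel_mem_complexMul.2 ⟨x, hx, mem_nbhd.1 hz⟩)
  rw [← ncard_nbhd a, ← ncard_nbhd x] at h
  rw [← mem_nbhd, Set.eq_of_subset_of_ncard_le hsub h]
  exact mem_nbhd.2 (rel_mem_complexMul.2 ⟨y, hy, hT.rel_self_mem y⟩)

/-- If `T` has index `p` in `R` then `xs` misses the class `xT`, hence meets fewer than `p` classes
`yT`; their number divides the `p`-power `n_s`, so there is only one. -/
theorem starMulSelf_subset_of_order_eq_prime_mul {p k : ℕ} (hp : p.Prime)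
    (hT : S.IsClosedSubset T) (hR : S.IsClosedSubset R) (hTR : T ⊆ R)
    (hord : S.order R = p * S.order T) (hsR : s ∈ R) (hsT : s ∉ T) (hs : S.valency s = p ^ k) :
    S.starMulSelf s ⊆ T := by
  obtain ⟨m, hm, horder⟩ := hT.exists_order_complexMul_singleton s
  have hdisj : Disjoint (S.complexMul {s} T) T := by
    refine Set.disjoint_left.2 (subset_iff_rel.2 fun x z hz hxz => hsT ?_)
    obtain ⟨y, rfl, hyz⟩ := rel_mem_complexMul.1 hz
    exact hT.rel_trans hxz (hT.rel_symm hyz)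
  have hsub : S.complexMul {s} T ⊆ R :=
    (complexMul_mono (Set.singleton_subset_iff.2 hsR) hTR).trans hR.2
  have hmp : m < p := by
    refine Nat.lt_of_mul_lt_mul_right (a := S.order T) ?_
    have := order_add_order_le hdisj hsub hTR
    have := hT.order_pos
    omega
  have hm1 : m = 1 := by
    obtain ⟨j, -, rfl⟩ := (Nat.dvd_prime_pow hp).1 (hs ▸ hm)
    have hj : j < 1 := (Nat.pow_lt_pow_iff_right hp.one_lt).1 (by rwa [pow_one])
    rw [Nat.lt_one_iff.1 hj, pow_zero]
  exact starMulSelf_subset_of_order_complexMul_le hT (by rw [horder, hm1, one_mul])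

theorem complexMul_subset_singleton_of_order_le_valency (hv : S.starMulSelf v ⊆ H)
    (hle : S.order H ≤ S.valency v) : S.complexMul {v} H ⊆ {v} := by
  refine subset_iff_rel.2 fun x z hz => ?_
  obtain ⟨y, hxy, hyz⟩ := rel_mem_complexMul.1 hz
  have hsub : S.nbhd x {v} ⊆ S.nbhd y H := fun w hw =>
    mem_nbhd.2 (starMulSelf_subset_iff.1 hv x y w hxy (mem_nbhd.1 hw))
  rw [← ncard_nbhd y, ← ncard_nbhd_singleton x] at hle
  rw [← mem_nbhd, Set.eq_of_subset_of_ncard_le hsub hle]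
  exact mem_nbhd.2 hyz

theorem starMulSelf_eq_of_order_le_valency (hv : S.starMulSelf v ⊆ H)
    (hle : S.order H ≤ S.valency v) : S.starMulSelf v = H := by
  refine hv.antisymm (subset_iff_rel.2 fun y z hyz => ?_)
  obtain ⟨x, hxy⟩ := exists_rel_left_eq v y
  refine rel_mem_starMulSelf.2 ⟨x, hxy, ?_⟩
  exact complexMul_subset_singleton_of_order_le_valency hv hle
    (rel_mem_complexMul.2 ⟨y, hxy, hyz⟩)

theorem complexMul_starMulSelf_subset (hv : S.starMulSelf v ⊆ S.thinRadical) :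
    S.complexMul {v} (S.starMulSelf v) ⊆ {v} := by
  refine subset_iff_rel.2 fun x z hz => ?_
  obtain ⟨y, hxy, hyz⟩ := rel_mem_complexMul.1 hz
  obtain ⟨a, hay, haz⟩ := rel_mem_starMulSelf.1 hyz
  obtain ⟨w, hxw, hwy⟩ := exists_triangle (hay.trans hxy.symm) z
  obtain rfl := eq_of_rel_eq_of_mem_thinRadical (hv hyz) (rel_swap_eq hwy)
  exact hxw.trans haz

theorem isClosedSubset_starMulSelf (hv : S.starMulSelf v ⊆ S.thinRadical) :
    S.IsClosedSubset (S.starMulSelf v) := by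
  refine isClosedSubset_of_rel_trans ?_ fun x y z hxy hyz => ?_
  · obtain ⟨x, y, h⟩ := exists_rel_eq v
    exact rel_self y ▸ rel_mem_starMulSelf.2 ⟨x, h, h⟩
  · obtain ⟨a, hax, hay⟩ := rel_mem_starMulSelf.1 hxy
    exact rel_mem_starMulSelf.2 ⟨a, hax, complexMul_starMulSelf_subset hv
      (rel_mem_complexMul.2 ⟨y, hay, hyz⟩)⟩

theorem IsCommutative.isClosedSubset_setOf_starMulSelf_subset (hc : S.IsCommutative)
    (hH : S.IsClosedSubset H) : S.IsClosedSubset {u | S.starMulSelf u ⊆ H} := by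
  refine isClosedSubset_of_rel_trans ?_ fun x₀ y₀ z₀ h₁ h₂ => ?_
  · exact starMulSelf_subset_of_mem_thinRadical isClosedSubset_thinRadical.one_mem hH
  · refine starMulSelf_subset_iff.2 fun x z w hz hw => ?_
    obtain ⟨y, hxy, hyz⟩ := exists_triangle hz.symm y₀
    obtain ⟨y', hxy', hyw⟩ := exists_triangle hw.symm y₀
    have hyy' : S.rel y y' ∈ H := h₁ (rel_mem_starMulSelf.2 ⟨x, hxy, hxy'⟩)
    obtain ⟨q, hzq, hqy'⟩ := hc.exists_parallelogram z y y'
    have hqw : S.rel q w ∈ H :=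
      h₂ (rel_mem_starMulSelf.2 ⟨y', (rel_swap_eq hqy').trans hyz, hyw⟩)
    exact hH.rel_trans (hzq ▸ hyy') hqw

end StarMulSelf

section Absorption

variable {X : Type*} [Finite X] (S : AssocScheme X)

/-- `v` absorbs `s` if `s^* s v = {v}`: a point that is in relation `v` with some point of a set
`xs` is in relation `v` with all of them. -/
def Absorbs (v s : S.Rel) : Prop := S.complexMul (S.starMulSelf s) {v} ⊆ {v}

variable {S} {H : Set S.Rel} {s v : S.Rel}

theorem Absorbs.rel_eq {a x y a' x' y' : X} (h : S.Absorbs (S.rel x y) (S.rel a x))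
    (hx : S.rel a' x' = S.rel a x) (hy : S.rel a' y' = S.rel a y) :
    S.rel x' y' = S.rel x y := by
  obtain ⟨w, haw, hwy⟩ := exists_triangle hy.symm x
  exact h (rel_mem_complexMul.2 ⟨w, rel_mem_starMulSelf.2 ⟨a', hx, haw⟩, hwy⟩)

theorem absorbs_of_mem_thinRadical (hs : s ∈ S.thinRadical) (v : S.Rel) : S.Absorbs v s := by
  refine subset_iff_rel.2 fun x y hxy => ?_
  obtain ⟨w, hxw, hwy⟩ := rel_mem_complexMul.1 hxy
  obtain rfl := rel_eq_one.1 (starMulSelf_subset_singleton_one hs hxw)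
  exact hwy

theorem IsCommutative.absorbs_of_starMulSelf_subset (hc : S.IsCommutative)
    (hv : S.complexMul {v} H ⊆ {v}) (hs : S.starMulSelf s ⊆ H) : S.Absorbs v s :=
  (complexMul_mono hs subset_rfl).trans ((hc.complexMul_subset_comm H {v}).trans hv)

theorem starMulSelf_subset_of_rel_mem_thinRadical {x y z : X} (hxy : S.rel x y ∈ S.thinRadical) :
    S.starMulSelf (S.rel x z) ⊆ S.starMulSelf (S.rel y z) := by
  refine starMulSelf_subset_iff.2 fun a b c hab hac => ?_
  obtain ⟨y', hay'⟩ := exists_rel_right_eq (S.rel x y) a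
  have habs := absorbs_of_mem_thinRadical hxy (S.rel y z)
  exact rel_mem_starMulSelf.2 ⟨y', habs.rel_eq hay' hab, habs.rel_eq hay' hac⟩

theorem starMulSelf_eq_of_rel_mem_thinRadical {x y z : X} (hxy : S.rel x y ∈ S.thinRadical) :
    S.starMulSelf (S.rel x z) = S.starMulSelf (S.rel y z) :=
  (starMulSelf_subset_of_rel_mem_thinRadical hxy).antisymm
    (starMulSelf_subset_of_rel_mem_thinRadical (isClosedSubset_thinRadical.rel_symm hxy))

end Absorption

section Extension

variable {X : Type*} [Finite X] (S : AssocScheme X)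

/-- A map is faithful on `D` if it preserves the relation of any two points of `D`; this is the
notion of a partial isomorphism of the scheme. -/
def IsFaithfulOn (g : X → X) (D : Set X) : Prop :=
  ∀ a ∈ D, ∀ b ∈ D, S.rel (g a) (g b) = S.rel a b

/-- Every partial isomorphism with nonempty domain extends by any one further point. -/
def HasOnePointExtensions : Prop :=
  ∀ (D : Set X), D.Nonempty → ∀ g, S.IsFaithfulOn g D → ∀ y, ∃ y', ∀ d ∈ D,
    S.rel (g d) y' = S.rel d y

/-- The automorphism group of the scheme, in the strict sense: every relation is preserved. -/
def aut : Subgroup (Equiv.Perm X) where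
  carrier := {g | ∀ a b, S.rel (g a) (g b) = S.rel a b}
  one_mem' _ _ := rfl
  mul_mem' {g k} hg hk a b := (hg (k a) (k b)).trans (hk a b)
  inv_mem' {g} hg a b := by simpa using (hg (g⁻¹ a) (g⁻¹ b)).symm

variable {S}

theorem eqOn_update_of_rel_eq [DecidableEq X] {g : X → X} {D : Set X} {y y' : X}
    (hy' : ∀ d ∈ D, S.rel (g d) y' = S.rel d y) :
    Set.EqOn (Function.update g y y') g D := by
  intro d hd
  obtain rfl | hne := eq_or_ne d y
  · rw [Function.update_self]
    exact (rel_eq_one.1 ((hy' d hd).trans (rel_self d))).symm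
  · exact Function.update_of_ne hne _ _

theorem IsFaithfulOn.update [DecidableEq X] {g : X → X} {D : Set X} {y y' : X}
    (hg : S.IsFaithfulOn g D) (hy' : ∀ d ∈ D, S.rel (g d) y' = S.rel d y) :
    S.IsFaithfulOn (Function.update g y y') (insert y D) := by
  have heq := eqOn_update_of_rel_eq hy'
  rintro a (rfl | ha) b (rfl | hb)
  · rw [rel_self, rel_self]
  · rw [heq hb, Function.update_self]
    exact rel_swap_eq (hy' b hb)
  · rw [heq ha, Function.update_self]
    exact hy' a ha
  · rw [heq ha, heq hb]
    exact hg a ha b hb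

theorem IsFaithfulOn.exists_mem_aut_eq {g : X → X} (hg : S.IsFaithfulOn g Set.univ) :
    ∃ σ ∈ S.aut, ⇑σ = g := by
  have hinj : Function.Injective g := fun a b hab =>
    rel_eq_one.1 (by rw [← hg a trivial b trivial, hab, rel_self])
  exact ⟨Equiv.ofBijective g (Finite.injective_iff_bijective.1 hinj),
    fun a b => hg a trivial b trivial, rfl⟩

theorem HasOnePointExtensions.exists_mem_aut_eqOn (hS : S.HasOnePointExtensions) {g : X → X}
    {D : Set X} (hD : D.Nonempty) (hg : S.IsFaithfulOn g D) : ∃ σ ∈ S.aut, Set.EqOn σ g D := by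
  classical
  have hext : ∀ E : Set X, ∃ f, S.IsFaithfulOn f (E ∪ D) ∧ Set.EqOn f g D := by
    intro E
    induction E, E.toFinite using Set.Finite.induction_on with
    | empty => exact ⟨g, by rwa [Set.empty_union], Set.eqOn_refl g D⟩
    | @insert y E _ _ ih =>
      obtain ⟨f, hf, hfg⟩ := ih
      obtain ⟨y', hy'⟩ := hS (E ∪ D) hD.inr f hf y
      refine ⟨Function.update f y y', ?_, ?_⟩
      · rw [Set.insert_union]
        exact hf.update hy'
      · exact ((eqOn_update_of_rel_eq hy').mono Set.subset_union_right).trans hfg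
  obtain ⟨f, hf, hfg⟩ := hext Set.univ
  rw [Set.univ_union] at hf
  obtain ⟨σ, hσ, rfl⟩ := hf.exists_mem_aut_eq
  exact ⟨σ, hσ, hfg⟩

theorem HasOnePointExtensions.exists_mem_aut (hS : S.HasOnePointExtensions) {x y x' y' : X}
    (h : S.rel x y = S.rel x' y') : ∃ σ ∈ S.aut, σ x = x' ∧ σ y = y' := by
  classical
  have hconst : S.IsFaithfulOn (fun _ => x') {x} := by
    rintro _ rfl _ rfl
    rw [rel_self, rel_self]
  have hy' : ∀ d ∈ ({x} : Set X), S.rel x' y' = S.rel d y := by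
    rintro _ rfl
    exact h.symm
  obtain ⟨σ, hσ, heq⟩ := hS.exists_mem_aut_eqOn (Set.insert_nonempty y {x}) (hconst.update hy')
  refine ⟨σ, hσ, ?_, ?_⟩
  · exact (heq (Set.mem_insert_of_mem y rfl)).trans (eqOn_update_of_rel_eq hy' rfl)
  · exact (heq (Set.mem_insert y {x})).trans (Function.update_self _ _ _)

theorem HasOnePointExtensions.orbit_aut (hS : S.HasOnePointExtensions) (x y : X) :
    MulAction.orbit S.aut (x, y) = (S.rel x y).1 := by
  ext ⟨x', y'⟩
  rw [mem_iff_rel_eq]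
  constructor
  · rintro ⟨σ, hσ⟩
    obtain ⟨rfl, rfl⟩ := Prod.ext_iff.1 hσ
    exact σ.2 x y
  · intro h
    obtain ⟨σ, hσ, rfl, rfl⟩ := hS.exists_mem_aut h.symm
    exact ⟨⟨σ, hσ⟩, rfl⟩

theorem HasOnePointExtensions.isSchurian (hS : S.HasOnePointExtensions) : S.IsSchurian := by
  refine ⟨S.aut, ⟨fun x y => ?_⟩, Set.Subset.antisymm ?_ ?_⟩
  · obtain ⟨σ, hσ, hxy, -⟩ := hS.exists_mem_aut ((rel_self x).trans (rel_self y).symm)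
    exact ⟨⟨σ, hσ⟩, hxy⟩
  · intro s hs
    obtain ⟨x, y, hxy⟩ := exists_rel_eq ⟨s, hs⟩
    exact ⟨(x, y), by simp only [hS.orbit_aut, hxy]⟩
  · rintro _ ⟨⟨x, y⟩, rfl⟩
    simp only [hS.orbit_aut]
    exact (S.rel x y).2

theorem IsFaithfulOn.exists_extension {g : X → X} {D : Set X} (hg : S.IsFaithfulOn g D) {a y : X}
    (ha : a ∈ D)
    (h : ∀ d ∈ D, S.rel a y ∈ S.thinRadical ∨ S.Absorbs (S.rel d y) (S.rel a d)) :
    ∃ y', ∀ d ∈ D, S.rel (g d) y' = S.rel d y := by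
  obtain ⟨y', hy'⟩ := exists_rel_right_eq (S.rel a y) (g a)
  refine ⟨y', fun d hd => ?_⟩
  obtain hthin | habs := h d hd
  · exact rel_swap_eq ((absorbs_of_mem_thinRadical hthin _).rel_eq hy' (hg a ha d hd))
  · exact habs.rel_eq (hg a ha d hd) hy'

/-- To extend a partial isomorphism to `y`, prescribe the image of `y` relative to a base point `a`
of the domain, chosen with `r(a, y)` thin if possible, and otherwise with `r(a, y) ∈ U` if
possible. -/
theorem isSchurian_of_absorbs {U : Set S.Rel} (hU : S.IsClosedSubset U)
    (hin : ∀ s ∈ U, ∀ v ∈ U, v ∉ S.thinRadical → S.Absorbs v s)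
    (hout : ∀ s, ∀ v ∉ U, S.Absorbs v s) : S.IsSchurian := by
  refine HasOnePointExtensions.isSchurian fun D hD g hg y => ?_
  by_cases hthin : ∃ a ∈ D, S.rel a y ∈ S.thinRadical
  · obtain ⟨a, ha, hay⟩ := hthin
    exact hg.exists_extension ha fun _ _ => .inl hay
  push Not at hthin
  by_cases hmem : ∃ a ∈ D, S.rel a y ∈ U
  · obtain ⟨a, ha, hay⟩ := hmem
    refine hg.exists_extension ha fun d hd => .inr ?_
    by_cases hdy : S.rel d y ∈ U
    · exact hin _ (hU.rel_trans hay (hU.rel_symm hdy)) _ hdy (hthin d hd)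
    · exact hout _ _ hdy
  push Not at hmem
  obtain ⟨a, ha⟩ := hD
  exact hg.exists_extension ha fun d hd => .inr (hout _ _ (hmem d hd))

end Extension

section Labelling

variable {X : Type*} [Finite X] (S : AssocScheme X) {A : Type*} [AddCommGroup A]

/-- A labelling of the points by an abelian group whose fibres are the classes `xT` and whose
differences `F y - F x` depend only on `r(x, y)`: it makes the quotient by `T` a subscheme of the
thin scheme of `A`. -/
structure IsLabelling (T : Set S.Rel) (F : X → A) : Prop where
  eq_iff : ∀ x y, F x = F y ↔ S.rel x y ∈ T
  sub_eq : ∀ {x y x' y'}, S.rel x y = S.rel x' y' → F y - F x = F y' - F x'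

variable {S} {T W : Set S.Rel} {n : ℕ}

theorem IsClosedSubset.exists_isLabelling (hT : S.IsClosedSubset T)
    (h : Isomorphic (S.quotientRels T) (cyclicRels n)) :
    ∃ F : X → ZMod n, S.IsLabelling T F := by
  obtain ⟨φ, ψ, hψ⟩ := h
  refine ⟨fun x => φ (S.toPointQuotient T x), fun x y => ?_, fun {x y x' y'} hxy => ?_⟩
  · rw [φ.apply_eq_iff_eq, hT.toPointQuotient_eq_iff]
  · have hmem : ∀ a b, S.rel a b = S.rel x y →
        (S.toPointQuotient T a, S.toPointQuotient T b) ∈ S.quotientRel T (S.rel x y) := by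
      refine fun a b hab => ⟨a, b, mem_nbhd.2 (rel_mem_complexMul.2 ⟨b, ?_, ?_⟩), rfl⟩
      · exact rel_mem_complexMul.2 ⟨a, hT.rel_self_mem a, hab⟩
      · exact hT.rel_self_mem b
    let c : S.quotientRels T := ⟨S.quotientRel T (S.rel x y), S.rel x y, rfl⟩
    have hxy₁ := hψ c _ _ (hmem x y rfl)
    have hxy₂ := hψ c _ _ (hmem x' y' hxy.symm)
    obtain ⟨g, hg⟩ := (ψ c).2
    rw [← hg] at hxy₁ hxy₂
    exact (eq_sub_of_add_eq' hxy₁).symm.trans (eq_sub_of_add_eq' hxy₂)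

namespace IsLabelling

theorem starMulSelf_subset {F : X → A} (hF : S.IsLabelling T F) (s : S.Rel) :
    S.starMulSelf s ⊆ T :=
  starMulSelf_subset_iff.2 fun _ x y hx hy =>
    (hF.eq_iff x y).1 (sub_left_injective (hF.sub_eq (hx.trans hy.symm)))

theorem rel_mem_of_sub_eq_nsmul {F : X → A} (hF : S.IsLabelling T F) (hW : S.IsClosedSubset W)
    (hTW : T ⊆ W) {a b : X} (hab : S.rel a b ∈ W) (k : ℕ) {x y : X}
    (h : F y - F x = k • (F b - F a)) : S.rel x y ∈ W := by
  induction k generalizing x with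
  | zero => exact hTW ((hF.eq_iff x y).1 (sub_eq_zero.1 (by rwa [zero_nsmul] at h)).symm)
  | succ k ih =>
    obtain ⟨z, hxz⟩ := exists_rel_right_eq (S.rel a b) x
    refine hW.rel_trans (hxz ▸ hab) (ih ?_)
    rw [← sub_sub_sub_cancel_right (F y) (F z) (F x), h, hF.sub_eq hxz, succ_nsmul,
      add_sub_cancel_right]

theorem isClosedSubset_setOf_sub_mem {F : X → A} (hF : S.IsLabelling T F) (B : AddSubgroup A) :
    S.IsClosedSubset {s | ∀ x y, S.rel x y = s → F y - F x ∈ B} := by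
  refine isClosedSubset_of_rel_trans (fun _ _ hxy => ?_) fun x y z hxy hyz x' z' hxz => ?_
  · rw [rel_eq_one.1 hxy, sub_self]
    exact B.zero_mem
  · rw [hF.sub_eq hxz, ← sub_add_sub_cancel]
    exact B.add_mem (hyz y z rfl) (hxy x y rfl)

theorem starMulSelf_subset_of_dvd [NeZero n] {F : X → ZMod n} (hF : S.IsLabelling T F)
    (hc : S.IsCommutative) (hthin : T ⊆ S.thinRadical) {a b x y : X}
    (h : F b - F a ∣ F y - F x) : S.starMulSelf (S.rel x y) ⊆ S.starMulSelf (S.rel a b) := by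
  have hclosed := isClosedSubset_starMulSelf ((hF.starMulSelf_subset (S.rel a b)).trans hthin)
  obtain ⟨c, hc'⟩ := h
  obtain ⟨k, rfl⟩ := ZMod.natCast_zmod_surjective c
  refine hF.rel_mem_of_sub_eq_nsmul (hc.isClosedSubset_setOf_starMulSelf_subset hclosed)
    (fun _ ht => starMulSelf_subset_of_mem_thinRadical (hthin ht) hclosed)
    (a := a) (b := b) (Set.Subset.refl _) k ?_
  rw [hc', nsmul_eq_mul, mul_comm]

end IsLabelling

end Labelling

section Cases

variable {X : Type*} [Finite X] {S : AssocScheme X} {R T : Set S.Rel} {p : ℕ}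

theorem IsCommutative.isSchurian_of_isomorphic_cyclicRels (hc : S.IsCommutative) (hp : p.Prime)
    (hT : S.IsClosedSubset T) (hthin : T ⊆ S.thinRadical)
    (h : Isomorphic (S.quotientRels T) (cyclicRels (p ^ 2))) : S.IsSchurian := by
  have : NeZero (p ^ 2) := ⟨pow_ne_zero 2 hp.ne_zero⟩
  obtain ⟨F, hF⟩ := hT.exists_isLabelling h
  have habs : ∀ {a b x y : X}, F b - F a ∣ F y - F x → S.Absorbs (S.rel a b) (S.rel x y) :=
    fun {a b _ _} hdvd => hc.absorbs_of_starMulSelf_subset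
      (complexMul_starMulSelf_subset ((hF.starMulSelf_subset (S.rel a b)).trans hthin))
      (hF.starMulSelf_subset_of_dvd hc hthin hdvd)
  let B : AddSubgroup (ZMod (p ^ 2)) := (Ideal.span {(p : ZMod (p ^ 2))}).toAddSubgroup
  have hB {d : ZMod (p ^ 2)} : d ∈ B ↔ (p : ZMod (p ^ 2)) ∣ d := Ideal.mem_span_singleton
  refine isSchurian_of_absorbs (hF.isClosedSubset_setOf_sub_mem B) ?_ ?_
  · intro s hs v hv hnonthin
    obtain ⟨x, y, rfl⟩ := exists_rel_eq s
    obtain ⟨a, b, rfl⟩ := exists_rel_eq v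
    refine habs (zmod_prime_sq_dvd_of_dvd_of_ne_zero hp (hB.1 (hs x y rfl)) (hB.1 (hv a b rfl)) ?_)
    exact fun hzero => hnonthin (hthin ((hF.eq_iff a b).1 (sub_eq_zero.1 hzero).symm))
  · intro s v hv
    obtain ⟨x, y, rfl⟩ := exists_rel_eq s
    obtain ⟨a, b, rfl⟩ := exists_rel_eq v
    refine habs (zmod_prime_pow_isUnit_of_not_dvd hp two_ne_zero fun hdvd => hv ?_).dvd
    intro a' b' hab
    rw [hF.sub_eq hab]
    exact hB.2 hdvd

theorem IsPScheme.dvd_valency (hpS : S.IsPScheme p) {s : S.Rel} (hs : s ∉ S.thinRadical) :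
    p ∣ S.valency s := by
  obtain ⟨k, hk⟩ := hpS.1 s
  rw [hk]
  refine dvd_pow_self p ?_
  rintro rfl
  exact hs hk

theorem IsPScheme.dvd_order_thinRadical_inter (hpS : S.IsPScheme p) (hR : p ∣ S.order R) :
    p ∣ S.order (S.thinRadical ∩ R) := by
  have hdiff : p ∣ ∑ᶠ s ∈ R \ S.thinRadical, S.valency s :=
    finsum_mem_induction (p ∣ ·) (dvd_zero p) (fun _ _ => dvd_add) fun _ hs => hpS.dvd_valency hs.2
  rw [order, ← finsum_mem_inter_add_sdiff S.thinRadical (Set.toFinite R)] at hR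
  rw [order, Set.inter_comm]
  exact (Nat.dvd_add_left hdiff).1 hR

theorem IsPScheme.order_thinRadical_inter (hpS : S.IsPScheme p) (hp : p.Prime)
    (hR : S.IsClosedSubset R) (hord : S.order R = p ^ 2) {s : S.Rel} (hsR : s ∈ R)
    (hs : s ∉ S.thinRadical) : S.order (S.thinRadical ∩ R) = p := by
  have hZ := isClosedSubset_thinRadical.inter hR
  have hdvd : p ∣ S.order (S.thinRadical ∩ R) :=
    hpS.dvd_order_thinRadical_inter (hord ▸ dvd_pow_self p two_ne_zero)
  obtain ⟨j, hj, hjord⟩ := (Nat.dvd_prime_pow hp).1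
    (hord ▸ hZ.order_dvd_order hR Set.inter_subset_right)
  have hj0 : j ≠ 0 := by
    rintro rfl
    exact hp.not_dvd_one (by rwa [hjord, pow_zero] at hdvd)
  have hj2 : j ≠ 2 := by
    rintro rfl
    have heq := eq_of_subset_of_order_le Set.inter_subset_right (hord.trans hjord.symm).le
    exact hs (Set.inter_eq_right.1 heq hsR)
  obtain rfl : j = 1 := by omega
  rw [hjord, pow_one]

theorem IsPScheme.starMulSelf_eq_thinRadical_inter (hpS : S.IsPScheme p) (hp : p.Prime)
    (hR : S.IsClosedSubset R) (hord : S.order R = p ^ 2) {s : S.Rel}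
    (hsR : s ∈ S.complexMul S.thinRadical R) (hs : s ∉ S.thinRadical) :
    S.starMulSelf s = S.thinRadical ∩ R := by
  obtain ⟨x, y, rfl⟩ := exists_rel_eq s
  obtain ⟨z, hxz, hzy⟩ := rel_mem_complexMul.1 hsR
  have hnonthin : S.rel z y ∉ S.thinRadical := fun h =>
    hs (isClosedSubset_thinRadical.rel_trans hxz h)
  have hZord := hpS.order_thinRadical_inter hp hR hord hzy hnonthin
  obtain ⟨k, hk⟩ := hpS.1 (S.rel z y)
  rw [starMulSelf_eq_of_rel_mem_thinRadical hxz]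
  refine starMulSelf_eq_of_order_le_valency ?_ ?_
  · exact starMulSelf_subset_of_order_eq_prime_mul hp (isClosedSubset_thinRadical.inter hR) hR
      Set.inter_subset_right (by rw [hord, hZord, sq]) hzy (fun h => hnonthin h.1) hk
  · exact hZord.trans_le (Nat.le_of_dvd (valency_pos _) (hpS.dvd_valency hnonthin))

theorem IsCommutative.isSchurian_of_isStronglyNormal (hc : S.IsCommutative) (hp : p.Prime)
    (hpS : S.IsPScheme p) (hR : S.IsStronglyNormal R) (hord : S.order R = p ^ 2)
    (hval : ∀ s ∉ S.complexMul S.thinRadical R, S.valency s = p ^ 2) : S.IsSchurian := by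
  refine isSchurian_of_absorbs (isClosedSubset_thinRadical.complexMul hc hR.1) ?_ ?_
  · intro s hsR v hvR hv
    by_cases hs : s ∈ S.thinRadical
    · exact absorbs_of_mem_thinRadical hs v
    have hseq := hpS.starMulSelf_eq_thinRadical_inter hp hR.1 hord hsR hs
    have hveq := hpS.starMulSelf_eq_thinRadical_inter hp hR.1 hord hvR hv
    have hvthin : S.starMulSelf v ⊆ S.thinRadical := hveq.trans_subset Set.inter_subset_left
    exact hc.absorbs_of_starMulSelf_subset (complexMul_starMulSelf_subset hvthin)
      (hseq.trans hveq.symm).subset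
  · intro s v hv
    have hle : S.order R ≤ S.valency v := (hord.trans (hval v hv).symm).le
    exact hc.absorbs_of_starMulSelf_subset
      (complexMul_subset_singleton_of_order_le_valency (hR.starMulSelf_subset v) hle)
      (hR.starMulSelf_subset s)

theorem IsCommutative.isSchurian_of_order_eq_prime_mul (hc : S.IsCommutative) (hp : p.Prime)
    (hpS : S.IsPScheme p) (hord : S.order Set.univ = p * S.order S.thinRadical) :
    S.IsSchurian := by
  have hthin : ∀ s, S.starMulSelf s ⊆ S.thinRadical := fun s => by
    by_cases hs : s ∈ S.thinRadical
    · exact starMulSelf_subset_of_mem_thinRadical hs isClosedSubset_thinRadical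
    obtain ⟨k, hk⟩ := hpS.1 s
    exact starMulSelf_subset_of_order_eq_prime_mul hp isClosedSubset_thinRadical
      isClosedSubset_univ (Set.subset_univ _) hord trivial hs hk
  refine isSchurian_of_absorbs isClosedSubset_univ (fun s _ v _ hv => ?_)
    fun _ _ hv => absurd trivial hv
  have hclosed := isClosedSubset_starMulSelf (hthin v)
  have huniv : {u | S.starMulSelf u ⊆ S.starMulSelf v} = Set.univ :=
    isClosedSubset_thinRadical.eq_of_order_eq_prime_mul hp
      (hc.isClosedSubset_setOf_starMulSelf_subset hclosed) isClosedSubset_univ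
      (fun u hu => starMulSelf_subset_of_mem_thinRadical hu hclosed) (Set.subset_univ _)
      (fun heq => hv (heq ▸ Set.Subset.refl _)) hord
  exact hc.absorbs_of_starMulSelf_subset (complexMul_starMulSelf_subset (hthin v))
    (Set.eq_univ_iff_forall.1 huniv s)

end Cases

end AssocScheme

theorem theorem1p1_general (p : ℕ) (hp : p.Prime) {X : Type*} [Finite X] (S : AssocScheme X)
    (hcomm : S.IsCommutative) (hpS : S.IsPScheme p)
    (h : (∃ T, S.IsClosedSubset T ∧ T ⊆ S.thinRadical ∧
            AssocScheme.Isomorphic (S.quotientRels T) (AssocScheme.cyclicRels (p ^ 2))) ∨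
         (∃ R, S.IsStronglyNormal R ∧ S.order R = p ^ 2 ∧
            ∀ s ∉ S.complexMul S.thinRadical R, S.valency s = p ^ 2) ∨
         S.order Set.univ = p * S.order S.thinRadical) :
    S.IsSchurian := by
  obtain ⟨T, hT, hthin, hiso⟩ | ⟨R, hR, hord, hval⟩ | hord := h
  · exact hcomm.isSchurian_of_isomorphic_cyclicRels hp hT hthin hiso
  · exact hcomm.isSchurian_of_isStronglyNormal hp hpS hR hord hval
  · exact hcomm.isSchurian_of_order_eq_prime_mul hp hpS hord

theorem theorem1p1 (p : ℕ) (hp : p.Prime) (hodd : Odd p) {X : Type*} [Finite X]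
    (S : AssocScheme X) (hcomm : S.IsCommutative) (hpS : S.IsPScheme p)
    (hord : S.order Set.univ = p ^ 4)
    (h : (S.thinResidue = S.thinRadical ∧ S.order S.thinRadical = p ^ 2 ∧
            AssocScheme.Isomorphic (S.quotientRels S.thinResidue)
              (AssocScheme.cyclicRels (p ^ 2))) ∨
         (S.order S.thinRadical = p ^ 2 ∧ S.order S.thinResidue = p ^ 2 ∧
            S.thinResidue ≠ S.thinRadical ∧
            ∀ s : S.Rel, s ∉ S.complexMul S.thinRadical S.thinResidue → S.valency s = p ^ 2) ∨
         S.order S.thinRadical = p ^ 3) :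
    S.IsSchurian := by
  refine theorem1p1_general p hp S hcomm hpS (h.imp ?_ (Or.imp ?_ ?_))
  · exact fun ⟨heq, _, hiso⟩ =>
      ⟨_, AssocScheme.isStronglyNormal_thinResidue.1, heq.subset, hiso⟩
  · exact fun ⟨_, hR, _, hval⟩ => ⟨_, AssocScheme.isStronglyNormal_thinResidue, hR, hval⟩
  · exact fun h => hord.trans (by rw [h, ← pow_succ'])
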